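/- Let $p$ be a prime and let $F$ be a field that contains a primitive $p$-th root of unity if $p$ is odd, and a primitive fourth root of unity if $p=2$. Let $G_F=\mathrm{Gal}(F_{sep}/F)$ be the absolute Galois group of $F$ and let $G_F(p)$ be its maximal pro-$p$ quotient. Write $[g,h]=ghg^{-1}h^{-1}$. (a) Let $S$ be a free pro-$p$ group on a set of free generators $X=\{x\}\sqcup\{y_i\mid i\in I\}$ ($I$ arbitrary, possibly empty or infinite; in the infinite case $X$ converges to $1$), and let $$1\longrightarrow R\longrightarrow S\stackrel{\pi}{\longrightarrow} G_F(p)\longrightarrow 1$$ be a minimal presentation, i.e. $\pi$ is a continuous surjective homomorphism whose kernel $R$ is contained in the Frattini subgroup $\overline{S^p[S,S]}$ of $S$. A *hyper-commutator* is an iterated commutator $[u_1,\dots,u_k]$, $k\ge 2$, with arbitrary bracketing, of letters $u_j$ of the formal alphabet $X\sqcup X^{-1}$. A *commutator expression* for $s\in S$ is an expression $s=c_1\cdots c_t$ ($t\ge 0$) in which every $c_j$ is a hyper-commutator. A commutator $[a,b]$ of two letters $a,b\in X\sqcup X^{-1}$ *appears* in the expression if it is a sub-commutator of some $c_j$ (for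 example, $[u_1,u_2]$ appears in $[[u_1,u_2],u_3]$ and $[u_2,u_3]$ does not). Then $R$ contains no element of the form $r=x^{p^l n}s$, where $l\ge 1$ and $n$ are integers with $\gcd(p,n)=1$ and $s$ is an element of the closed commutator subgroup $[S,S]$ that has a commutator expression in which every appearing commutator $[a,b]$ of letters satisfies $a\ne x^{\pm1}$ and $b\neq x^{\pm 1}$. (b) In particular, let $n\ge 1$ be an odd integer, let $k\ge 1$ be an integer, let $S$ be a free pro-$p$ group on $x_1,\dots,x_n$, and let $\langle r\rangle$ be the closed normal subgroup of $S$ generated by $$r=x_1^{p^k}[x_2,x_3][x_4,x_5]\cdots[x_{n-1},x_n].$$ Then $S/\langle r\rangle$ is not isomorphic, as a topological group, to $G_F(p)$. -/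

import Mathlib

open Filter Topology
open scoped commutatorElement

universe u v w

namespace ProP

section Groups

variable (p : ℕ)

/-- A pro-`p` group: a compact totally disconnected topological group all of whose quotients by
open normal subgroups are (finite) `p`-groups. -/
structure IsProPGroup (G : Type u) [Group G] [TopologicalSpace G] [IsTopologicalGroup G] :
    Prop where
  compactSpace : CompactSpace G
  totallyDisconnectedSpace : TotallyDisconnectedSpace G
  isPGroup_quotient : ∀ (N : Subgroup G) [N.Normal], IsOpen (N : Set G) → IsPGroup p (G ⧸ N)

/-- `S` is the free pro-`p` group on the family of generators `ι : X → S`: the family converges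
to `1` (every neighbourhood of `1` contains all but finitely many generators), and every family
`f : X → P` in a pro-`p` group that converges to `1` extends uniquely to a continuous
homomorphism `S → P`. -/
structure IsFreeProPGroup {X : Type w} {S : Type v} [Group S] [TopologicalSpace S]
    [IsTopologicalGroup S] (ι : X → S) : Prop where
  isProPGroup : IsProPGroup p S
  tendsto_one : Tendsto ι cofinite (𝓝 1)
  existsUnique_extension : ∀ (P : Type v) [Group P] [TopologicalSpace P] [IsTopologicalGroup P],
    IsProPGroup p P → ∀ f : X → P, Tendsto f cofinite (𝓝 1) →
      ∃! φ : S →ₜ* P, ∀ a, φ (ι a) = f a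

/-- The Frattini subgroup of a pro-`p` group `S`: the closed subgroup generated by all `p`-th
powers and all commutators. -/
def frattiniSubgroup (S : Type v) [Group S] [TopologicalSpace S] [IsTopologicalGroup S] :
    Subgroup S :=
  (Subgroup.closure ({g | ∃ a : S, g = a ^ p} ∪ {g | ∃ a b : S, g = ⁅a, b⁆})).topologicalClosure

/-- `1 → ker π → S → G → 1` is a minimal presentation: `π` is onto and its kernel is contained in
the Frattini subgroup of `S`. -/
structure IsMinimalPresentation {S : Type v} [Group S] [TopologicalSpace S]
    [IsTopologicalGroup S] {G : Type u} [Group G] [TopologicalSpace G] (π : S →ₜ* G) : Prop where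
  surjective : Function.Surjective π
  ker_le_frattini : (π : S →* G).ker ≤ frattiniSubgroup p S

/-- The intersection of all open normal subgroups of `G` with quotient a `p`-group. -/
def proPKernel (G : Type u) [Group G] [TopologicalSpace G] : Subgroup G :=
  sInf {N : Subgroup G | ∃ _ : N.Normal, IsOpen (N : Set G) ∧ IsPGroup p (G ⧸ N)}

instance proPKernel_normal (G : Type u) [Group G] [TopologicalSpace G] :
    (proPKernel p G).Normal := by
  refine ⟨fun n hn g => ?_⟩
  rw [proPKernel, Subgroup.mem_sInf] at hn ⊢
  rintro N ⟨hN, h⟩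
  exact hN.conj_mem n (hn N ⟨hN, h⟩) g

/-- The maximal pro-`p` quotient of a profinite group, with the quotient topology. -/
abbrev MaxProPQuotient (G : Type u) [Group G] [TopologicalSpace G] : Type u :=
  G ⧸ proPKernel p G

/-- The absolute Galois group of `F`, with the Krull topology. -/
abbrev AbsGal (F : Type u) [Field F] : Type u := SeparableClosure F ≃ₐ[F] SeparableClosure F

/-- The maximal pro-`p` quotient of the absolute Galois group of `F`. -/
abbrev GalP (F : Type u) [Field F] : Type u := MaxProPQuotient p (AbsGal F)

/-- `F` contains a primitive `p`-th root of unity if `p` is odd, and a primitive fourth root of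
unity if `p = 2`. -/
def HasRootsOfUnity (F : Type u) [Field F] : Prop :=
  (p ≠ 2 → ∃ ζ : F, IsPrimitiveRoot ζ p) ∧ (p = 2 → ∃ ζ : F, IsPrimitiveRoot ζ 4)

end Groups

/-- The closed normal subgroup generated by `r`. -/
def closedNormalClosure {S : Type v} [Group S] [TopologicalSpace S] [IsTopologicalGroup S]
    (r : S) : Subgroup S :=
  (Subgroup.normalClosure {r}).topologicalClosure

instance closedNormalClosure_normal {S : Type v} [Group S] [TopologicalSpace S]
    [IsTopologicalGroup S] (r : S) : (closedNormalClosure r).Normal :=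
  Subgroup.is_normal_topologicalClosure _

/-- A letter of the formal alphabet `X ⊔ X⁻¹`. -/
inductive Letter (X : Type w) : Type w
  | pos (a : X) : Letter X
  | neg (a : X) : Letter X

/-- A formal iterated commutator, with arbitrary bracketing, of letters in `A`; a single letter
is allowed as the degenerate case of length one. -/
inductive BracketWord (A : Type w) : Type w
  | letter (a : A) : BracketWord A
  | bracket (b c : BracketWord A) : BracketWord A

/-- The letter `a` or `a⁻¹` as a group element. -/
def Letter.eval {X : Type w} {S : Type v} [Group S] (ι : X → S) : Letter X → S
  | .pos a => ι a
  | .neg a => (ι a)⁻¹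

namespace BracketWord

/-- The value of an iterated commutator, where `⁅g, h⁆ = g * h * g⁻¹ * h⁻¹`. -/
def eval {X : Type w} {S : Type v} [Group S] (ι : X → S) : BracketWord (Letter X) → S
  | letter a => a.eval ι
  | bracket b c => ⁅b.eval ι, c.eval ι⁆

/-- `c` is a hyper-commutator, that is, it has at least two letters. -/
def IsHyperCommutator {A : Type w} (c : BracketWord A) : Prop :=
  ∃ b b' : BracketWord A, c = bracket b b'

/-- The commutator `[a, b]` of two letters appears in the given word as a sub-commutator. -/
def Appears {A : Type w} (a b : A) : BracketWord A → Prop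
  | letter _ => False
  | bracket c d => (c = letter a ∧ d = letter b) ∨ Appears a b c ∨ Appears a b d

end BracketWord

/-- The list `cs = [c₁, …, cₖ]` of hyper-commutators in the letters `X ⊔ X⁻¹` is a commutator
expression `s = c₁ ⋯ cₖ`. -/
def IsCommutatorExpression {X : Type w} {S : Type v} [Group S] (ι : X → S)
    (cs : List (BracketWord (Letter X))) (s : S) : Prop :=
  (∀ c ∈ cs, c.IsHyperCommutator) ∧ s = (cs.map (BracketWord.eval ι)).prod

/-- The family of generators `{x} ∪ {y i | i ∈ I}`, where `none` indexes `x`. -/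
def generators {I : Type w} {S : Type v} (x : S) (y : I → S) : Option I → S
  | none => x
  | some i => y i

/-- The letter is neither `x` nor `x⁻¹`. -/
def Letter.AvoidsX {I : Type w} (a : Letter (Option I)) : Prop :=
  a ≠ .pos none ∧ a ≠ .neg none

/-- The word `x₁ ^ (p ^ k) [x₂, x₃] [x₄, x₅] ⋯ [x₂ₘ, x₂ₘ₊₁]` in `n = 2 m + 1` generators
(numbered from `0` in the code). -/
def oddRelation (p k m : ℕ) {S : Type v} [Group S] (x : Fin (2 * m + 1) → S) : S :=
  x 0 ^ p ^ k *
    (List.ofFn fun j : Fin m =>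
      ⁅x ⟨2 * j + 1, by omega⟩, x ⟨2 * j + 2, by omega⟩⁆).prod

end ProP

/-
Choose lifts to the absolute Galois group of the images of the free generators. By freeness and
minimality, every finitely supported assignment of `p`-th roots of unity to the generators extends
to a character of the Galois group, which Hilbert 90 turns into the cocycle `σ ↦ σ α / α` of a
`p`-th root `α`. Extracting further `p`-th roots and correcting the resulting error, which takes
values in the `p`-th roots of unity, lifts this to `p ^ m`-th roots of unity. So there is a
`p ^ m`-th root `α` of an element of `F` such that the lift `σ` of `x` satisfies `σ α = ζ α` with
`ζ` of order `p ^ m`, while the lifts of the other generators fix `α`. Commutators of the latter fix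
all conjugates of `α`, since the action on roots of unity is commutative. As `σ ζ = ζ ^ t` with
`t ≡ 1` modulo `p` (modulo `4` if `p = 2`), lifting the exponent shows that `α` has period exactly
`p ^ m` under `σ`. A relation `x ^ z * s` therefore forces `p ^ m ∣ z` for every `m ≥ 2`, that is,
`z = 0`.
-/

namespace ProP

lemma emultiplicity_geom_sum {p : ℕ} (hp : p.Prime) {q : ℤ} (hq : (p : ℤ) ∣ q - 1)
    (hq4 : p = 2 → 4 ∣ q - 1) (n : ℕ) :
    emultiplicity (p : ℤ) (∑ i ∈ Finset.range n, q ^ i) = emultiplicity (p : ℤ) n := by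
  rcases eq_or_ne q 1 with rfl | hq1
  · simp
  have hp' : Prime (p : ℤ) := Nat.prime_iff_prime_int.1 hp
  have hpq : ¬ (p : ℤ) ∣ q := fun h => hp'.not_dvd_one ((dvd_sub_right h).1 hq)
  have lifting_exponent : emultiplicity (p : ℤ) (q ^ n - 1) =
      emultiplicity (p : ℤ) (q - 1) + emultiplicity (p : ℤ) n := by
    rcases hp.eq_two_or_odd' with rfl | hodd
    · simpa using Int.two_pow_sub_pow' n (hq4 rfl) (by simpa using hpq)
    · simpa [Int.natCast_emultiplicity] using Int.emultiplicity_pow_sub_pow hp hodd hq hpq n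
  rw [← mul_geom_sum, emultiplicity_mul hp'] at lifting_exponent
  exact ENat.add_right_injective_of_ne_top (finiteMultiplicity_iff_emultiplicity_ne_top.1
    (Int.finiteMultiplicity_iff.2 ⟨by simpa using hp.ne_one, sub_ne_zero.2 hq1⟩)) lifting_exponent

section RootsOfUnity

variable {F : Type u} {K : Type v} [Field F] [Field K] [Algebra F K]

lemma HasRootsOfUnity.exists_isPrimitiveRoot {p : ℕ} (hF : HasRootsOfUnity p F) :
    ∃ η : F, IsPrimitiveRoot η p := by
  by_cases hp : p = 2
  · subst hp
    obtain ⟨ζ, hζ⟩ := hF.2 rfl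
    exact ⟨ζ ^ 2, hζ.pow (by norm_num) (by norm_num)⟩
  · exact hF.1 hp

lemma exists_rootsOfUnity_algebraMap_eq {n : ℕ} [NeZero n] {η : F} (hη : IsPrimitiveRoot η n)
    {ω : K} (hω : ω ^ n = 1) : ∃ u : rootsOfUnity n F, algebraMap F K (u : Fˣ) = ω := by
  obtain ⟨i, -, hi⟩ := (hη.map_of_injective (algebraMap F K).injective).eq_pow_of_pow_eq_one hω
  exact ⟨hη.toRootsOfUnity ^ i, by simpa using hi⟩

lemma apply_eq_self_of_pow_eq_one {n : ℕ} [NeZero n] {η : F} (hη : IsPrimitiveRoot η n)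
    (σ : K ≃ₐ[F] K) {ω : K} (hω : ω ^ n = 1) : σ ω = ω := by
  obtain ⟨u, rfl⟩ := exists_rootsOfUnity_algebraMap_eq hη hω
  exact σ.commutes _

lemma exists_apply_eq_pow {n : ℕ} [NeZero n] (σ : K ≃ₐ[F] K) {ω : K} (hω : ω ^ n = 1) :
    ∃ t : ℕ, σ ω = ω ^ t := by
  obtain ⟨t, ht⟩ := map_rootsOfUnity_eq_pow_self σ (rootsOfUnity.mkOfPowEq ω hω)
  exact ⟨t, by simpa using ht⟩

lemma dvd_sub_one_of_apply_eq_pow {n d : ℕ} [NeZero n] (hd : d ∣ n) {η : F}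
    (hη : IsPrimitiveRoot η d) {ζ : K} (hζ : IsPrimitiveRoot ζ n) {σ : K ≃ₐ[F] K} {t : ℕ}
    (ht : σ ζ = ζ ^ t) : (d : ℤ) ∣ t - 1 := by
  have : NeZero d := ⟨ne_zero_of_dvd_ne_zero (NeZero.ne n) hd⟩
  obtain ⟨e, he⟩ := hd
  have hω : IsPrimitiveRoot (ζ ^ e) d := hζ.pow (NeZero.pos n) (he.trans (mul_comm d e))
  have hfix : (ζ ^ e) ^ t = ζ ^ e := by
    rw [← pow_right_comm, ← ht, ← map_pow, apply_eq_self_of_pow_eq_one hη σ hω.pow_eq_one]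
  rw [← hω.zpow_eq_one_iff_dvd, zpow_sub_one₀ (hω.ne_zero (NeZero.ne d)), zpow_natCast, hfix,
    mul_inv_cancel₀ (hω.ne_zero (NeZero.ne d))]

lemma pow_apply_eq_pow_geom_sum_mul {σ : K ≃ₐ[F] K} {ζ α : K} {t : ℕ} (hζ : σ ζ = ζ ^ t)
    (hα : σ α = ζ * α) (n : ℕ) : (σ ^ n) α = ζ ^ (∑ i ∈ Finset.range n, t ^ i) * α := by
  induction n with
  | zero => simp
  | succ n ih =>
    rw [pow_succ', AlgEquiv.mul_apply, ih, map_mul, map_pow, hζ, hα, geom_sum_succ, pow_succ,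
      pow_mul, mul_assoc]

-- For `p = 2`, a primitive fourth root of unity in `F` excludes the inversion `σ ζ = ζ⁻¹`, under
-- which `σ ^ 2` would already fix `α`.
lemma period_eq_prime_pow {p : ℕ} [hp : Fact p.Prime] (hF : HasRootsOfUnity p F) {m : ℕ}
    (hm : 2 ≤ m) {ζ : K} (hζ : IsPrimitiveRoot ζ (p ^ m)) {α : K} (hα : α ≠ 0) {σ : K ≃ₐ[F] K}
    (hσ : σ α = ζ * α) : MulAction.period σ α = p ^ m := by
  obtain ⟨η, hη⟩ := hF.exists_isPrimitiveRoot
  obtain ⟨t, ht⟩ := exists_apply_eq_pow σ hζ.pow_eq_one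
  have ht1 : (p : ℤ) ∣ t - 1 :=
    dvd_sub_one_of_apply_eq_pow (dvd_pow_self p (by omega)) hη hζ ht
  have ht4 : p = 2 → (4 : ℤ) ∣ t - 1 := by
    rintro rfl
    obtain ⟨ω, hω⟩ := hF.2 rfl
    exact dvd_sub_one_of_apply_eq_pow (pow_dvd_pow 2 hm) hω hζ ht
  refine Nat.dvd_right_iff_eq.1 fun n => ?_
  rw [← MulAction.pow_smul_eq_iff_period_dvd, AlgEquiv.smul_def,
    pow_apply_eq_pow_geom_sum_mul ht hσ, mul_eq_right₀ hα, hζ.pow_eq_one_iff_dvd]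
  zify
  rw [pow_dvd_iff_le_emultiplicity, pow_dvd_iff_le_emultiplicity,
    emultiplicity_geom_sum hp.out ht1 ht4]

end RootsOfUnity

section RadicalFixingSubgroup

variable {F : Type u} {K : Type v} [Field F] [Field K] [Algebra F K]

/-- The subgroup of `Gal(K/F)` that corresponds to the radical extension generated by all `n`-th
roots of `a` in `K`. If `K` contains a nonzero such root and the `n`-th roots of unity, it is the
Kummer extension `F(ζₙ, a ^ (1 / n))`. -/
def radicalFixingSubgroup (K : Type v) [Field K] [Algebra F K] (n : ℕ) (a : F) :
    Subgroup (K ≃ₐ[F] K) :=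
  fixingSubgroup (K ≃ₐ[F] K) {β : K | β ^ n = algebraMap F K a}

lemma mem_radicalFixingSubgroup {n : ℕ} {a : F} {σ : K ≃ₐ[F] K} :
    σ ∈ radicalFixingSubgroup K n a ↔ ∀ β, β ^ n = algebraMap F K a → σ β = β := by
  simp [radicalFixingSubgroup, mem_fixingSubgroup_iff]

instance radicalFixingSubgroup_normal (n : ℕ) (a : F) : (radicalFixingSubgroup K n a).Normal := by
  refine ⟨fun σ hσ τ => mem_radicalFixingSubgroup.2 fun β hβ => ?_⟩
  have hτβ : (τ⁻¹ β) ^ n = algebraMap F K a := by rw [← map_pow, hβ, AlgEquiv.commutes]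
  rw [AlgEquiv.mul_apply, AlgEquiv.mul_apply, mem_radicalFixingSubgroup.1 hσ _ hτβ]
  exact τ.apply_symm_apply β

lemma isOpen_radicalFixingSubgroup [Algebra.IsAlgebraic F K] {n : ℕ} (hn : 0 < n) (a : F) :
    IsOpen (radicalFixingSubgroup K n a : Set (K ≃ₐ[F] K)) := by
  classical
  set roots : Set K := {β | β ^ n = algebraMap F K a}
  have hroots : roots.Finite :=
    (Polynomial.nthRoots n (algebraMap F K a)).toFinset.finite_toSet.subset fun β hβ => by
      simpa [roots, Polynomial.mem_nthRoots hn] using hβ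
  have := hroots.to_subtype
  have : FiniteDimensional F (IntermediateField.adjoin F roots) :=
    IntermediateField.finiteDimensional_adjoin fun β _ => Algebra.IsIntegral.isIntegral β
  refine Subgroup.isOpen_mono (fun σ hσ => ?_)
    (IntermediateField.adjoin F roots).fixingSubgroup_isOpen
  exact mem_radicalFixingSubgroup.2 fun β hβ =>
    (IntermediateField.mem_fixingSubgroup_iff _ _).1 hσ β (IntermediateField.subset_adjoin F _ hβ)

lemma pow_apply_eq_self {p : ℕ} [NeZero p] {η : F} (hη : IsPrimitiveRoot η p) {σ : K ≃ₐ[F] K}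
    {β : K} (hβ : σ (β ^ p) = β ^ p) : (σ ^ p) β = β := by
  rcases eq_or_ne β 0 with rfl | hβ0
  · simp
  have hω : (σ β / β) ^ p = 1 := by rw [div_pow, ← map_pow, hβ, div_self (pow_ne_zero p hβ0)]
  have hσω : σ (σ β / β) = (σ β / β) ^ 1 := by
    rw [pow_one, apply_eq_self_of_pow_eq_one hη σ hω]
  rw [pow_apply_eq_pow_geom_sum_mul hσω (div_mul_cancel₀ _ hβ0).symm]
  simp [hω]

lemma pow_pow_apply_eq_self {p : ℕ} [NeZero p] {η : F} (hη : IsPrimitiveRoot η p)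
    {σ : K ≃ₐ[F] K} {m : ℕ} {β : K} (hβ : σ (β ^ p ^ m) = β ^ p ^ m) : (σ ^ p ^ m) β = β := by
  induction m generalizing β with
  | zero => simpa using hβ
  | succ m ih =>
    rw [pow_succ, pow_mul]
    exact pow_apply_eq_self hη (ih (by rwa [← pow_mul, ← pow_succ']))

lemma isPGroup_quotient_radicalFixingSubgroup {p : ℕ} [NeZero p] {η : F}
    (hη : IsPrimitiveRoot η p) (m : ℕ) (a : F) :
    IsPGroup p ((K ≃ₐ[F] K) ⧸ radicalFixingSubgroup K (p ^ m) a) := by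
  intro τ
  obtain ⟨σ, rfl⟩ := QuotientGroup.mk_surjective τ
  refine ⟨m, ?_⟩
  rw [← QuotientGroup.mk_pow, QuotientGroup.eq_one_iff, mem_radicalFixingSubgroup]
  intro β hβ
  exact pow_pow_apply_eq_self hη (by rw [hβ, σ.commutes])

lemma commutatorElement_apply_of_pow_eq_one {n : ℕ} [NeZero n] (σ τ : K ≃ₐ[F] K) {ω : K}
    (hω : ω ^ n = 1) : ⁅σ, τ⁆ ω = ω := by
  have hcomm : ∀ ξ : K, ξ ^ n = 1 → σ (τ ξ) = τ (σ ξ) := by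
    intro ξ hξ
    obtain ⟨s, hs⟩ := exists_apply_eq_pow σ hξ
    obtain ⟨t, ht⟩ := exists_apply_eq_pow τ hξ
    rw [ht, hs, map_pow, map_pow, hs, ht, pow_right_comm]
  have hξ : (σ⁻¹ (τ⁻¹ ω)) ^ n = 1 := by rw [← map_pow, ← map_pow, hω, map_one, map_one]
  have h := hcomm _ hξ
  rw [commutatorElement_def]
  exact h.trans ((congrArg τ (σ.apply_symm_apply _)).trans (τ.apply_symm_apply ω))

lemma commutatorElement_mem_radicalFixingSubgroup {n : ℕ} [NeZero n] {a : F} {α : K} (hα0 : α ≠ 0)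
    (hα : α ^ n = algebraMap F K a) {σ τ : K ≃ₐ[F] K} (hσ : σ α = α) (hτ : τ α = α) :
    ⁅σ, τ⁆ ∈ radicalFixingSubgroup K n a := by
  rw [mem_radicalFixingSubgroup]
  intro β hβ
  have hfix : ⁅σ, τ⁆ ∈ MulAction.stabilizer (K ≃ₐ[F] K) α :=
    Subgroup.commutator_le_self _ (Subgroup.commutator_mem_commutator hσ hτ)
  have hω : (β / α) ^ n = 1 := by rw [div_pow, hβ, hα, div_self (hα ▸ pow_ne_zero n hα0)]
  rw [← div_mul_cancel₀ β hα0, map_mul, commutatorElement_apply_of_pow_eq_one σ τ hω]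
  exact congrArg (β / α * ·) hfix

end RadicalFixingSubgroup

section MaxProPQuotient

variable {p : ℕ} {G : Type u} [Group G] [TopologicalSpace G]

lemma proPKernel_le {N : Subgroup G} [hN : N.Normal] (ho : IsOpen (N : Set G))
    (hp : IsPGroup p (G ⧸ N)) : proPKernel p G ≤ N :=
  sInf_le ⟨hN, ho, hp⟩

lemma mk_mem_map_mk'_iff {N : Subgroup G} [N.Normal] (ho : IsOpen (N : Set G))
    (hp : IsPGroup p (G ⧸ N)) {g : G} :
    (g : MaxProPQuotient p G) ∈ N.map (QuotientGroup.mk' (proPKernel p G)) ↔ g ∈ N := by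
  change g ∈ (N.map (QuotientGroup.mk' (proPKernel p G))).comap (QuotientGroup.mk' _) ↔ g ∈ N
  rw [QuotientGroup.comap_map_mk', sup_eq_right.2 (proPKernel_le ho hp)]

variable [IsTopologicalGroup G]

lemma isOpen_map_mk' {N : Subgroup G} (ho : IsOpen (N : Set G)) :
    IsOpen (N.map (QuotientGroup.mk' (proPKernel p G)) : Set (MaxProPQuotient p G)) :=
  QuotientGroup.isOpenMap_coe _ ho

lemma eventually_mem_of_tendsto {X : Type*} {l : Filter X} {g : X → G}
    (hg : Tendsto (fun a => (g a : MaxProPQuotient p G)) l (𝓝 1)) {N : Subgroup G} [N.Normal]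
    (ho : IsOpen (N : Set G)) (hp : IsPGroup p (G ⧸ N)) : ∀ᶠ a in l, g a ∈ N := by
  filter_upwards [hg ((isOpen_map_mk' ho).mem_nhds (one_mem _))] with a ha
  exact (mk_mem_map_mk'_iff ho hp).1 ha

instance : T2Space (MaxProPQuotient p G) := by
  have : IsClosed (proPKernel p G : Set G) := by
    rw [proPKernel, Subgroup.coe_sInf]
    exact isClosed_biInter fun N ⟨_, hN, _⟩ => Subgroup.isClosed_of_isOpen N hN
  infer_instance

end MaxProPQuotient

section Kummer

variable {F : Type u} {K : Type v} [Field F] [Field K] [Algebra F K]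

lemma exists_apply_eq_algebraMap_mul_of_finiteDimensional [FiniteDimensional F K]
    (χ : (K ≃ₐ[F] K) →* Fˣ) :
    ∃ β : K, β ≠ 0 ∧ ∀ σ : K ≃ₐ[F] K, σ β = algebraMap F K (χ σ) * β := by
  let c : (K ≃ₐ[F] K) → Kˣ := fun σ => Units.map (algebraMap F K) (χ σ)
  have hc : groupCohomology.IsMulCocycle₁ c := fun σ τ => by
    ext
    simp [c, AlgEquiv.smul_units_def, mul_comm]
  obtain ⟨β, hβ⟩ := groupCohomology.isMulCoboundary₁_of_isMulCocycle₁_of_aut_to_units c hc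
  refine ⟨β, β.ne_zero, fun σ => ?_⟩
  have h : σ • β = c σ * β := div_eq_iff_eq_mul.1 (hβ σ)
  exact congrArg Units.val h

lemma exists_apply_eq_algebraMap_mul [IsGalois F K] (χ : (K ≃ₐ[F] K) →* Fˣ)
    (hχ : IsOpen (χ.ker : Set (K ≃ₐ[F] K))) :
    ∃ β : K, β ≠ 0 ∧ ∀ σ : K ≃ₐ[F] K, σ β = algebraMap F K (χ σ) * β := by
  obtain ⟨L, _, _, hL⟩ := (krullTopology_mem_nhds_one_iff_of_normal F K _).1
    (hχ.mem_nhds (one_mem χ.ker))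
  let res : (K ≃ₐ[F] K) →* (L ≃ₐ[F] L) := AlgEquiv.restrictNormalHom L
  have hker : res.ker ≤ χ.ker := (IntermediateField.restrictNormalHom_ker L).trans_le hL
  let χL : (L ≃ₐ[F] L) →* Fˣ :=
    res.liftOfSurjective (AlgEquiv.restrictNormalHom_surjective K) ⟨χ, hker⟩
  have hχL : ∀ σ, χL (res σ) = χ σ := fun σ =>
    MonoidHom.liftOfRightInverse_comp_apply _ _ _ ⟨χ, hker⟩ σ
  obtain ⟨β, hβ0, hβ⟩ := exists_apply_eq_algebraMap_mul_of_finiteDimensional χL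
  refine ⟨β, by simpa using hβ0, fun σ => ?_⟩
  calc σ β = res σ β := (AlgEquiv.restrictNormal_commutes σ L β).symm
    _ = algebraMap F K (χ σ) * β := by rw [hβ, hχL]; rfl

variable {X : Type w}

/-- The family `g` in `Gal(K/F)` is *Kummer independent* at `n` if every finitely supported family
of `n`-th roots of unity is of the form `g a α / α` for a single `n`-th root `α ∈ Kˣ` of an element
of `F`, that is, if it is the restriction to `g` of the Kummer cocycle of an element of `Fˣ`. -/
def KummerIndependent (n : ℕ) (g : X → K ≃ₐ[F] K) : Prop :=
  ∀ f : X → K, (∀ a, f a ^ n = 1) → (∀ᶠ a in cofinite, f a = 1) →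
    ∃ (α : K) (b : F), α ≠ 0 ∧ α ^ n = algebraMap F K b ∧ ∀ a, g a α = f a * α

lemma KummerIndependent.pow [Algebra.IsAlgebraic F K] [IsSepClosed K] {p : ℕ} [NeZero p]
    {η : F} (hη : IsPrimitiveRoot η p) {g : X → K ≃ₐ[F] K}
    (hg : Tendsto (fun a => (g a : MaxProPQuotient p (K ≃ₐ[F] K))) cofinite (𝓝 1))
    (hgp : KummerIndependent p g) (m : ℕ) : KummerIndependent (p ^ m) g := by
  have : NeZero (p : K) := (hη.map_of_injective (algebraMap F K).injective).neZero'
  induction m with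
  | zero => exact fun f hf _ => ⟨1, 1, one_ne_zero, by simp, fun a => by simpa using (hf a).symm⟩
  | succ m ih =>
    intro f hf hf1
    obtain ⟨β, b, hβ0, hβ, hgβ⟩ := ih (fun a => f a ^ p)
      (fun a => by rw [← pow_mul, ← pow_succ', hf]) (hf1.mono fun a ha => by simp [ha])
    obtain ⟨γ, rfl⟩ := IsSepClosed.exists_pow_nat_eq β p
    have hγ0 : γ ≠ 0 := (pow_ne_zero_iff (NeZero.ne p)).1 hβ0
    have hγ : γ ^ p ^ (m + 1) = algebraMap F K b := by rw [pow_succ', pow_mul, hβ]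
    have hgγ : ∀ a, g a γ ≠ 0 := fun a => by simpa using hγ0
    have hgγ1 : ∀ᶠ a in cofinite, g a γ = γ := by
      filter_upwards [eventually_mem_of_tendsto hg (isOpen_radicalFixingSubgroup (NeZero.pos _) b)
        (isPGroup_quotient_radicalFixingSubgroup hη (m + 1) b)] with a ha
      exact mem_radicalFixingSubgroup.1 ha γ hγ
    -- The cocycle of `γ` agrees with `f` up to `p`-th roots of unity.
    obtain ⟨δ, d, hδ0, hδ, hgδ⟩ := hgp (fun a => f a * γ / g a γ)
      (fun a => by
        rw [div_pow, mul_pow, ← map_pow, hgβ, div_self (hgβ a ▸ (map_ne_zero (g a)).2 hβ0)])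
      (by filter_upwards [hf1, hgγ1] with a hfa hga; rw [hfa, hga, one_mul, div_self hγ0])
    refine ⟨γ * δ, b * d ^ p ^ m, mul_ne_zero hγ0 hδ0, ?_, fun a => ?_⟩
    · rw [mul_pow, hγ, pow_succ', pow_mul, hδ, map_mul, map_pow]
    · have := hgγ a
      rw [map_mul, hgδ]
      field_simp

lemma KummerIndependent.exists_radicalFixingSubgroup [IsSepClosed K] {p : ℕ} [Fact p.Prime]
    (hF : HasRootsOfUnity p F) {m : ℕ} (hm : 2 ≤ m) {g : X → K ≃ₐ[F] K}
    (hg : KummerIndependent (p ^ m) g) (x : X) :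
    ∃ b : F, (∀ a ≠ x, ∀ a' ≠ x, ⁅g a, g a'⁆ ∈ radicalFixingSubgroup K (p ^ m) b) ∧
      ∀ z : ℤ, g x ^ z ∈ radicalFixingSubgroup K (p ^ m) b → (p : ℤ) ^ m ∣ z := by
  classical
  obtain ⟨η, hη⟩ := hF.exists_isPrimitiveRoot
  have : NeZero (p : K) := (hη.map_of_injective (algebraMap F K).injective).neZero'
  have : NeZero ((p ^ m : ℕ) : K) := by rw [Nat.cast_pow]; infer_instance
  obtain ⟨ζ, hζ⟩ := HasEnoughRootsOfUnity.exists_primitiveRoot K (p ^ m)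
  obtain ⟨α, b, hα0, hα, hgα⟩ := hg (fun a => if a = x then ζ else 1)
    (fun a => by split_ifs <;> simp [hζ.pow_eq_one])
    ((Set.finite_singleton x).subset fun a ha => by by_contra h; simp_all)
  have hfix : ∀ a ≠ x, g a α = α := fun a ha => by simp [hgα, ha]
  refine ⟨b, fun a ha a' ha' =>
    commutatorElement_mem_radicalFixingSubgroup hα0 hα (hfix a ha) (hfix a' ha'), fun z hz => ?_⟩
  have hz' : g x ^ z • α = α := mem_radicalFixingSubgroup.1 hz α hα
  have hperiod := period_eq_prime_pow hF hm hζ hα0 ((hgα x).trans (by simp))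
  rw [MulAction.zpow_smul_eq_iff_period_dvd, hperiod] at hz'
  exact_mod_cast hz'

end Kummer

section TopologicalSubgroups

variable {p : ℕ} {S : Type v} [Group S] [TopologicalSpace S] [IsTopologicalGroup S]

lemma pow_mem_frattiniSubgroup (a : S) : a ^ p ∈ frattiniSubgroup p S :=
  Subgroup.le_topologicalClosure _ (Subgroup.subset_closure (Or.inl ⟨a, rfl⟩))

lemma commutatorElement_mem_frattiniSubgroup (a b : S) : ⁅a, b⁆ ∈ frattiniSubgroup p S :=
  Subgroup.le_topologicalClosure _ (Subgroup.subset_closure (Or.inr ⟨a, b, rfl⟩))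

lemma isClosed_frattiniSubgroup : IsClosed (frattiniSubgroup p S : Set S) :=
  Subgroup.isClosed_topologicalClosure _

lemma frattiniSubgroup_le {N : Subgroup S} (hN : IsClosed (N : Set S)) (hpow : ∀ a : S, a ^ p ∈ N)
    (hcomm : ∀ a b : S, ⁅a, b⁆ ∈ N) : frattiniSubgroup p S ≤ N := by
  refine Subgroup.topologicalClosure_minimal _ ((Subgroup.closure_le N).2 ?_) hN
  rintro _ (⟨a, rfl⟩ | ⟨a, b, rfl⟩)
  exacts [hpow a, hcomm a b]

instance frattiniSubgroup_normal : (frattiniSubgroup p S).Normal :=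
  Subgroup.Normal.of_commutator_le S <|
    Subgroup.commutator_le.2 fun a _ b _ => commutatorElement_mem_frattiniSubgroup a b

lemma closedNormalClosure_le {r : S} {N : Subgroup S} [N.Normal] (hN : IsClosed (N : Set S))
    (hr : r ∈ N) : closedNormalClosure r ≤ N :=
  Subgroup.topologicalClosure_minimal _
    (Subgroup.normalClosure_le_normal (Set.singleton_subset_iff.2 hr)) hN

lemma mem_closedNormalClosure (r : S) : r ∈ closedNormalClosure r :=
  Subgroup.le_topologicalClosure _ (Subgroup.subset_normalClosure rfl)

end TopologicalSubgroups

section Presentations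

variable {p : ℕ} {X : Type w} {S : Type v} [Group S] [TopologicalSpace S] [IsTopologicalGroup S]
  {ι : X → S} {G : Type u} [Group G] [TopologicalSpace G]

lemma isProPGroup_of_finite {P : Type u} [Group P] [TopologicalSpace P] [IsTopologicalGroup P]
    [Finite P] [DiscreteTopology P] (hP : IsPGroup p P) : IsProPGroup p P :=
  ⟨inferInstance, inferInstance, fun N _ _ => hP.to_quotient N⟩

lemma IsFreeProPGroup.exists_monoidHom (hS : IsFreeProPGroup p ι) {A : Type*} [Group A] [Finite A]
    (hA : IsPGroup p A) {f : X → A} (hf : ∀ᶠ a in cofinite, f a = 1) :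
    ∃ φ : S →* A, IsOpen (φ.ker : Set S) ∧ ∀ a, φ (ι a) = f a := by
  -- The universal property only sees groups in the universe of `S`.
  let e : Shrink.{v} A ≃* A := Shrink.mulEquiv
  have : Finite (Shrink.{v} A) := Finite.of_equiv A e.symm.toEquiv
  let _ : TopologicalSpace (Shrink.{v} A) := ⊥
  have : DiscreteTopology (Shrink.{v} A) := ⟨rfl⟩
  have : IsTopologicalGroup (Shrink.{v} A) := {}
  obtain ⟨φ, hφ, -⟩ := hS.existsUnique_extension _ (isProPGroup_of_finite (hA.of_equiv e.symm))
    (fun a => e.symm (f a))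
    (tendsto_nhds_of_eventually_eq (hf.mono fun a ha => by rw [ha, map_one]))
  refine ⟨(e : Shrink.{v} A →* A).comp (φ : S →* Shrink.{v} A), ?_, fun a => by simp [hφ]⟩
  rw [MonoidHom.ker_mulEquiv_comp]
  exact (isOpen_discrete {1}).preimage φ.continuous_toFun

lemma IsMinimalPresentation.exists_monoidHom_comp_eq [CompactSpace S] [T2Space G] {π : S →ₜ* G}
    (hπ : IsMinimalPresentation p π) {A : Type*} [CommGroup A] (hA : ∀ a : A, a ^ p = 1)
    {φ : S →* A} (hφ : IsOpen (φ.ker : Set S)) :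
    ∃ χ : G →* A, IsOpen (χ.ker : Set G) ∧ ∀ s, χ (π s) = φ s := by
  have hker : (π : S →* G).ker ≤ φ.ker := hπ.ker_le_frattini.trans <|
    frattiniSubgroup_le (Subgroup.isClosed_of_isOpen _ hφ)
      (fun a => by rw [MonoidHom.mem_ker, map_pow, hA])
      (fun a b => by
        rw [MonoidHom.mem_ker, map_commutatorElement, commutatorElement_eq_one_iff_mul_comm,
          mul_comm])
  let χ : G →* A := (π : S →* G).liftOfSurjective hπ.surjective ⟨φ, hker⟩
  have hχ : ∀ s, χ (π s) = φ s := fun s =>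
    MonoidHom.liftOfRightInverse_comp_apply (π : S →* G) _ _ ⟨φ, hker⟩ s
  have hquot : IsQuotientMap π :=
    π.continuous_toFun.isClosedMap.isQuotientMap π.continuous_toFun hπ.surjective
  refine ⟨χ, hquot.isOpen_preimage.1 ?_, hχ⟩
  convert hφ using 1
  ext s
  simp [MonoidHom.mem_ker, hχ]

lemma exists_isMinimalPresentation_of_quotient {N : Subgroup S} [N.Normal]
    (hN : N ≤ frattiniSubgroup p S) (e : (S ⧸ N) ≃ₜ* G) :
    ∃ π : S →ₜ* G, IsMinimalPresentation p π ∧ (π : S →* G).ker = N := by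
  let π : S →ₜ* G :=
    { toMonoidHom := (e : (S ⧸ N) →* G).comp (QuotientGroup.mk' N)
      continuous_toFun := e.continuous_toFun.comp QuotientGroup.continuous_mk }
  have hker : (π : S →* G).ker = N := by
    ext s
    exact (map_eq_one_iff e e.injective).trans (QuotientGroup.eq_one_iff s)
  exact ⟨π, ⟨e.surjective.comp QuotientGroup.mk_surjective, hker.trans_le hN⟩, hker⟩

lemma IsFreeProPGroup.kummerIndependent {F : Type u} [Field F] [NeZero p] {η : F}
    (hη : IsPrimitiveRoot η p) (hS : IsFreeProPGroup p ι) {π : S →ₜ* GalP p F}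
    (hπ : IsMinimalPresentation p π) {g : X → AbsGal F} (hg : ∀ a, (g a : GalP p F) = π (ι a)) :
    KummerIndependent p g := by
  have := hS.isProPGroup.compactSpace
  have exponent : ∀ u : rootsOfUnity p F, u ^ p = 1 := fun u => Subtype.ext u.2
  intro f hf hf1
  choose u hu using fun a => exists_rootsOfUnity_algebraMap_eq hη (hf a)
  have hu1 : ∀ᶠ a in cofinite, u a = 1 := by
    filter_upwards [hf1] with a ha
    ext
    exact (algebraMap F (SeparableClosure F)).injective (by simp [hu, ha])
  obtain ⟨φ, hφ, hφι⟩ :=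
    hS.exists_monoidHom (fun u : rootsOfUnity p F => ⟨1, by rw [pow_one, exponent]⟩) hu1
  obtain ⟨χ, hχ, hχπ⟩ := hπ.exists_monoidHom_comp_eq exponent hφ
  let χF : AbsGal F →* Fˣ := (rootsOfUnity p F).subtype.comp (χ.comp (QuotientGroup.mk' _))
  have hχF : IsOpen (χF.ker : Set (AbsGal F)) := by
    convert hχ.preimage (QuotientGroup.continuous_mk (N := proPKernel p (AbsGal F))) using 1
    ext σ
    simp [χF, MonoidHom.mem_ker]
  obtain ⟨β, hβ0, hβ⟩ := exists_apply_eq_algebraMap_mul χF hχF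
  have hβp : ∀ σ : AbsGal F, σ (β ^ p) = β ^ p := fun σ => by
    have hσ : ((χF σ : Fˣ) : F) ^ p = 1 := (mem_rootsOfUnity' p _).1 (χ σ).2
    rw [map_pow, hβ, mul_pow, ← map_pow, hσ, map_one, one_mul]
  obtain ⟨b, hb⟩ := (InfiniteGalois.mem_range_algebraMap_iff_fixed _).2 hβp
  refine ⟨β, b, hβ0, hb.symm, fun a => ?_⟩
  have hχg : χ (g a) = u a := by rw [hg, hχπ, hφι]
  rw [hβ, ← hu, ← hχg]
  rfl

end Presentations

section CommutatorsAvoiding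

lemma Letter.AvoidsX.exists_eval_eq {I : Type w} {S : Type v} [Group S] {x : S} {y : I → S}
    {a : Letter (Option I)} (ha : a.AvoidsX) :
    ∃ i ≠ none, a.eval (generators x y) = generators x y i ∨
      a.eval (generators x y) = (generators x y i)⁻¹ := by
  rcases a with (_ | i) | (_ | i)
  · exact absurd rfl ha.1
  · exact ⟨some i, Option.some_ne_none i, Or.inl rfl⟩
  · exact absurd rfl ha.2
  · exact ⟨some i, Option.some_ne_none i, Or.inr rfl⟩

lemma commutatorElement_mem_iff_commute_mk {G : Type*} [Group G] {N : Subgroup G} [N.Normal]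
    {g h : G} : ⁅g, h⁆ ∈ N ↔ Commute (g : G ⧸ N) (h : G ⧸ N) := by
  rw [← commutatorElement_eq_one_iff_commute, ← QuotientGroup.eq_one_iff]
  rfl

variable {S : Type v} [Group S] [TopologicalSpace S] [IsTopologicalGroup S]

/-- The closed normal subgroup generated by the commutators of members of the family `ι` other than
`ι x`. Products of hyper-commutators in which `ι x` and its inverse do not appear in a commutator of
two letters lie in it. -/
def commutatorsAvoiding {X : Type w} (ι : X → S) (x : X) : Subgroup S :=
  (Subgroup.normalClosure {s | ∃ a ≠ x, ∃ b ≠ x, ⁅ι a, ι b⁆ = s}).topologicalClosure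

instance commutatorsAvoiding_normal {X : Type w} (ι : X → S) (x : X) :
    (commutatorsAvoiding ι x).Normal :=
  Subgroup.is_normal_topologicalClosure _

lemma commutatorElement_mem_commutatorsAvoiding {X : Type w} (ι : X → S) {x a b : X} (ha : a ≠ x)
    (hb : b ≠ x) : ⁅ι a, ι b⁆ ∈ commutatorsAvoiding ι x :=
  Subgroup.le_topologicalClosure _ (Subgroup.subset_normalClosure ⟨a, ha, b, hb, rfl⟩)

lemma commutatorsAvoiding_le {X : Type w} {ι : X → S} {x : X} {N : Subgroup S} [N.Normal]
    (hN : IsClosed (N : Set S)) (h : ∀ a ≠ x, ∀ b ≠ x, ⁅ι a, ι b⁆ ∈ N) :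
    commutatorsAvoiding ι x ≤ N := by
  refine Subgroup.topologicalClosure_minimal _ (Subgroup.normalClosure_le_normal ?_) hN
  rintro _ ⟨a, ha, b, hb, rfl⟩
  exact h a ha b hb

variable {I : Type w} {x : S} {y : I → S}

lemma Letter.AvoidsX.commutatorElement_eval_mem {a b : Letter (Option I)} (ha : a.AvoidsX)
    (hb : b.AvoidsX) : ⁅a.eval (generators x y), b.eval (generators x y)⁆ ∈
      commutatorsAvoiding (generators x y) none := by
  obtain ⟨i, hi, hai⟩ := ha.exists_eval_eq (x := x) (y := y)
  obtain ⟨j, hj, hbj⟩ := hb.exists_eval_eq (x := x) (y := y)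
  have hij := commutatorElement_mem_iff_commute_mk.1
    (commutatorElement_mem_commutatorsAvoiding (generators x y) hi hj)
  rw [commutatorElement_mem_iff_commute_mk]
  rcases hai with hai | hai <;> rcases hbj with hbj | hbj <;>
    simpa only [hai, hbj, QuotientGroup.mk_inv, Commute.inv_left_iff, Commute.inv_right_iff]
      using hij

lemma BracketWord.eval_mem_commutatorsAvoiding :
    ∀ {c : BracketWord (Letter (Option I))}, c.IsHyperCommutator →
      (∀ a b, c.Appears a b → a.AvoidsX ∧ b.AvoidsX) →
      c.eval (generators x y) ∈ commutatorsAvoiding (generators x y) none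
  | letter _, ⟨_, _, h⟩, _ => nomatch h
  | bracket (letter a) (letter b), _, hav =>
    have ⟨ha, hb⟩ := hav a b (Or.inl ⟨rfl, rfl⟩)
    ha.commutatorElement_eval_mem hb
  | bracket (bracket c c') _, _, hav =>
    Subgroup.commutator_le_left _ ⊤ <| Subgroup.commutator_mem_commutator
      (eval_mem_commutatorsAvoiding ⟨c, c', rfl⟩ fun a b h => hav a b (Or.inr (Or.inl h)))
      (Subgroup.mem_top _)
  | bracket _ (bracket d d'), _, hav =>
    Subgroup.commutator_le_right ⊤ _ <| Subgroup.commutator_mem_commutator (Subgroup.mem_top _)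
      (eval_mem_commutatorsAvoiding ⟨d, d', rfl⟩ fun a b h => hav a b (Or.inr (Or.inr h)))

lemma IsCommutatorExpression.mem_commutatorsAvoiding {cs : List (BracketWord (Letter (Option I)))}
    {s : S} (hs : IsCommutatorExpression (generators x y) cs s)
    (hav : ∀ c ∈ cs, ∀ a b, c.Appears a b → a.AvoidsX ∧ b.AvoidsX) :
    s ∈ commutatorsAvoiding (generators x y) none := by
  rw [hs.2]
  refine Subgroup.list_prod_mem _ fun z hz => ?_
  obtain ⟨c, hc, rfl⟩ := List.mem_map.1 hz
  exact BracketWord.eval_mem_commutatorsAvoiding (hs.1 c hc) (hav c hc)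

lemma exists_oddRelation_eq (p k m : ℕ) (x : Fin (2 * m + 1) → S) :
    ∃ s ∈ commutatorsAvoiding x 0, oddRelation p k m x = x 0 ^ p ^ k * s := by
  refine ⟨_, Subgroup.list_prod_mem _ fun z hz => ?_, rfl⟩
  obtain ⟨j, rfl⟩ := (List.mem_ofFn' _ _).1 hz
  exact commutatorElement_mem_commutatorsAvoiding x (Fin.ne_of_val_ne (Nat.succ_ne_zero _))
    (Fin.ne_of_val_ne (Nat.succ_ne_zero _))

lemma oddRelation_mem_frattiniSubgroup {p k : ℕ} (hk : 1 ≤ k) {m : ℕ}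
    (x : Fin (2 * m + 1) → S) : oddRelation p k m x ∈ frattiniSubgroup p S := by
  obtain ⟨s, hs, hr⟩ := exists_oddRelation_eq p k m x
  obtain ⟨k, rfl⟩ := Nat.exists_eq_add_of_le hk
  rw [hr, pow_add, pow_one, pow_mul]
  exact mul_mem (pow_mem (pow_mem_frattiniSubgroup _) _)
    (commutatorsAvoiding_le isClosed_frattiniSubgroup
      (fun a _ b _ => commutatorElement_mem_frattiniSubgroup _ _) hs)

end CommutatorsAvoiding

lemma IsFreeProPGroup.prime_pow_dvd_of_zpow_mem {p : ℕ} [Fact p.Prime] {F : Type u} [Field F]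
    (hF : HasRootsOfUnity p F) {X : Type w} {S : Type v} [Group S] [TopologicalSpace S]
    [IsTopologicalGroup S] {ι : X → S} (hS : IsFreeProPGroup p ι) {π : S →ₜ* GalP p F}
    (hπ : IsMinimalPresentation p π) {x : X} {z : ℤ}
    (hz : ι x ^ z ∈ (π : S →* GalP p F).ker ⊔ commutatorsAvoiding ι x) {m : ℕ} (hm : 2 ≤ m) :
    (p : ℤ) ^ m ∣ z := by
  obtain ⟨η, hη⟩ := hF.exists_isPrimitiveRoot
  choose g hg using fun a => QuotientGroup.mk_surjective (π (ι a))
  have hg1 : Tendsto (fun a => (g a : GalP p F)) cofinite (𝓝 1) := by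
    have hπ1 : Tendsto π (𝓝 1) (𝓝 1) := map_one π ▸ π.continuous_toFun.tendsto 1
    simp only [hg]
    exact hπ1.comp hS.tendsto_one
  obtain ⟨b, hcomm, hpow⟩ :=
    ((hS.kummerIndependent hη hπ hg).pow hη hg1 m).exists_radicalFixingSubgroup hF hm x
  let N := radicalFixingSubgroup (SeparableClosure F) (p ^ m) b
  have hNo : IsOpen (N : Set (AbsGal F)) := isOpen_radicalFixingSubgroup (NeZero.pos _) b
  have hNp : IsPGroup p (AbsGal F ⧸ N) := isPGroup_quotient_radicalFixingSubgroup hη m b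
  let N' : Subgroup (GalP p F) := N.map (QuotientGroup.mk' _)
  have : N'.Normal := Subgroup.Normal.map inferInstance _ (QuotientGroup.mk'_surjective _)
  let M := N'.comap (π : S →* GalP p F)
  have hM : IsClosed (M : Set S) :=
    (N'.isClosed_of_isOpen (isOpen_map_mk' hNo)).preimage π.continuous_toFun
  have hMcomm : ∀ a ≠ x, ∀ a' ≠ x, ⁅ι a, ι a'⁆ ∈ M := fun a ha a' ha' => by
    change π ⁅ι a, ι a'⁆ ∈ N'
    rw [map_commutatorElement, ← hg, ← hg]
    exact (mk_mem_map_mk'_iff hNo hNp).2 (hcomm a ha a' ha')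
  have hzM : π (ι x ^ z) ∈ N' :=
    sup_le (Subgroup.ker_le_comap _ _) (commutatorsAvoiding_le hM hMcomm) hz
  rw [map_zpow, ← hg] at hzM
  exact hpow z ((mk_mem_map_mk'_iff hNo hNp).1 hzM)

end ProP

theorem theorem3p6_general {p : ℕ} [hp : Fact p.Prime] {F : Type u} [Field F]
    (hF : ProP.HasRootsOfUnity p F) {X : Type w} {S : Type v} [Group S] [TopologicalSpace S]
    [IsTopologicalGroup S] {ι : X → S} (hS : ProP.IsFreeProPGroup p ι) {π : S →ₜ* ProP.GalP p F}
    (hπ : ProP.IsMinimalPresentation p π) (x : X) {z : ℤ} (hz : z ≠ 0) {s : S}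
    (hs : s ∈ ProP.commutatorsAvoiding ι x) : ι x ^ z * s ∉ (π : S →* ProP.GalP p F).ker := by
  intro hr
  have hx : ι x ^ z ∈ (π : S →* ProP.GalP p F).ker ⊔ ProP.commutatorsAvoiding ι x :=
    (mul_mem_cancel_right (Subgroup.mem_sup_right hs)).1 (Subgroup.mem_sup_left hr)
  obtain ⟨m, hm⟩ : FiniteMultiplicity (p : ℤ) z :=
    Int.finiteMultiplicity_iff.2 ⟨by simpa using hp.out.ne_one, hz⟩
  have hdvd : (p : ℤ) ^ (m + 2) ∣ z := hS.prime_pow_dvd_of_zpow_mem hF hπ hx (by omega)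
  exact hm ((pow_dvd_pow _ (by omega)).trans hdvd)

theorem theorem3p6 (p : ℕ) [Fact p.Prime] (F : Type u) [Field F]
    (hF : ProP.HasRootsOfUnity p F) :
    (∀ (I : Type w) (S : Type v) [Group S] [TopologicalSpace S] [IsTopologicalGroup S]
        (x : S) (y : I → S) (_ : ProP.IsFreeProPGroup p (ProP.generators x y))
        (π : S →ₜ* ProP.GalP p F) (_ : ProP.IsMinimalPresentation p π),
        ¬ ∃ (l : ℕ) (n : ℤ) (s : S) (cs : List (ProP.BracketWord (ProP.Letter (Option I)))),
          1 ≤ l ∧ IsCoprime (p : ℤ) n ∧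
          s ∈ (commutator S).topologicalClosure ∧
          ProP.IsCommutatorExpression (ProP.generators x y) cs s ∧
          (∀ c ∈ cs, ∀ a b : ProP.Letter (Option I), c.Appears a b → a.AvoidsX ∧ b.AvoidsX) ∧
          x ^ ((p : ℤ) ^ l * n) * s ∈ (π : S →* ProP.GalP p F).ker) ∧
    (∀ (m k : ℕ) (_ : 1 ≤ k) (S : Type v) [Group S] [TopologicalSpace S] [IsTopologicalGroup S]
        (x : Fin (2 * m + 1) → S) (_ : ProP.IsFreeProPGroup p x),
        IsEmpty ((S ⧸ ProP.closedNormalClosure (ProP.oddRelation p k m x)) ≃ₜ*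
          ProP.GalP p F)) := by
  constructor
  · rintro I S _ _ _ x y hS π hπ ⟨l, n, s, cs, -, hn, -, hs, hav, hr⟩
    have hexp : (p : ℤ) ^ l * n ≠ 0 := by
      refine mul_ne_zero (pow_ne_zero l (NeZero.ne _)) ?_
      rintro rfl
      exact (Nat.prime_iff_prime_int.1 Fact.out).not_isUnit (isCoprime_zero_right.1 hn)
    exact theorem3p6_general hF hS hπ none hexp (hs.mem_commutatorsAvoiding hav) hr
  · intro m k hk S _ _ _ x hS
    refine ⟨fun e => ?_⟩
    obtain ⟨π, hπ, hker⟩ := ProP.exists_isMinimalPresentation_of_quotient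
      (ProP.closedNormalClosure_le ProP.isClosed_frattiniSubgroup
        (ProP.oddRelation_mem_frattiniSubgroup hk x)) e
    obtain ⟨s, hs, hr⟩ := ProP.exists_oddRelation_eq p k m x
    have hexp : (p : ℤ) ^ k ≠ 0 := pow_ne_zero k (NeZero.ne _)
    refine theorem3p6_general hF hS hπ 0 hexp hs ?_
    rw [hker, ← Nat.cast_pow, zpow_natCast, ← hr]
    exact ProP.mem_closedNormalClosure _
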